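/- Let $n\ge 1$ and let $D^0=\{z\in\mathbb{C}^n:\ |z_1|+\dots+|z_n|<1\}$ be the unit hypercone. Let $\mu$ be the probability measure $$d\mu=\frac{(n-1)!}{(2\pi i)^n}\,d|z_1|\wedge\dots\wedge d|z_{n-1}|\wedge\frac{dz_1}{z_1}\wedge\dots\wedge\frac{dz_n}{z_n}$$ on $\partial D^0$; that is, $\mu$ has density $(n-1)!/(2\pi)^n$ with respect to $dt_1\cdots dt_{n-1}\,d\theta_1\cdots d\theta_n$ in the coordinates $z_j=t_je^{i\theta_j}$, $t_1,\dots,t_{n-1}\ge 0$, $t_n=1-t_1-\dots-t_{n-1}\ge 0$, $0<\theta_j\le 2\pi$. For $r>0$ let $\mu_r$, a measure on $\partial(rD^0)$, be the image of $\mu$ under $z\mapsto rz$. Let $L_n(D^0)$ be the largest number (the supremum of all numbers) $r>0$ with the following property: whenever a power series $\sum_\alpha c_\alpha z^\alpha$ (over all multi-indices $\alpha\in\mathbb{Z}_{\ge 0}^n$) converges in $D^0$ and $\bigl|\sum_\alpha c_\alpha z^\alpha\bigr|<1$ for all $z\in D^0$, then $$\sum_\alpha\|c_\alpha z^\alpha\|_{L^1(\partial(rD^0),\,\mu_r)}<1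 .$$ Then for every $n\ge 1$ $$0.238843<L_n(D^0)\le \frac13 .$$ -/

import Mathlib

open MeasureTheory

noncomputable section

namespace BohrHypercone

/-- The unit hypercone `{z ∈ ℂⁿ : |z₁| + ⋯ + |zₙ| < 1}`. -/
def hypercone (n : ℕ) : Set (Fin n → ℂ) :=
  {z | ∑ i, ‖z i‖ < 1}

/-- The monomial `z^α = z₁^α₁ ⋯ zₙ^αₙ`. -/
def monomial {n : ℕ} (α : Fin n → ℕ) (z : Fin n → ℂ) : ℂ :=
  ∏ i, z i ^ α i

/-- The range of `(|z₁|, …, |zₙ₋₁|)` on the boundary of the hypercone: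
the solid simplex `{t : tᵢ ≥ 0, t₁ + ⋯ + tₙ₋₁ ≤ 1}` in `ℝⁿ⁻¹`. -/
def solidSimplex (n : ℕ) : Set (Fin (n - 1) → ℝ) :=
  {t | (∀ i, 0 ≤ t i) ∧ ∑ i, t i ≤ 1}

/-- The moduli of the point of the boundary of the hypercone whose first `n - 1` coordinates have
moduli `t`: they are `t₁, …, tₙ₋₁, 1 - (t₁ + ⋯ + tₙ₋₁)`. -/
def modulus (n : ℕ) (t : Fin (n - 1) → ℝ) (i : Fin n) : ℝ :=
  if h : (i : ℕ) < n - 1 then t ⟨i, h⟩ else 1 - ∑ j, t j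

/-- The parametrization of the boundary of the hypercone by moduli and arguments,
`zⱼ = |zⱼ| exp (i θⱼ)`. -/
def polarPoint (n : ℕ) (p : (Fin (n - 1) → ℝ) × (Fin n → ℝ)) : Fin n → ℂ :=
  fun i => (modulus n p.1 i : ℂ) * Complex.exp ((p.2 i : ℂ) * Complex.I)

/-- The measure
`(n-1)! / (2πi)ⁿ d|z₁| ∧ ⋯ ∧ d|zₙ₋₁| ∧ dz₁/z₁ ∧ ⋯ ∧ dzₙ/zₙ` on the boundary of the hypercone.
Since `dzⱼ/zⱼ = d|zⱼ|/|zⱼ| + i dθⱼ`, and the `|zⱼ|` depend on only `n - 1` parameters there, it is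
`(n-1)! / (2π)ⁿ d|z₁| ⋯ d|zₙ₋₁| dθ₁ ⋯ dθₙ`. It is regarded as a measure on `ℂⁿ`. -/
def mu (n : ℕ) : Measure (Fin n → ℂ) :=
  ENNReal.ofReal ((Nat.factorial (n - 1) : ℝ) / (2 * Real.pi) ^ n) •
    Measure.map (polarPoint n)
      ((volume.restrict (solidSimplex n)).prod
        (volume.restrict (Set.univ.pi fun _ : Fin n => Set.Ioc (0 : ℝ) (2 * Real.pi))))

/-- The image of `mu n` under the homothety `z ↦ r z`, a measure carried by the boundary of the
hypercone of size `r`. -/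
def muScaled (n : ℕ) (r : ℝ) : Measure (Fin n → ℂ) :=
  Measure.map (fun z => r • z) (mu n)

/-- The power series `∑ c_α z^α` converges in the unit hypercone and its sum has modulus less
than `1` there. -/
def BoundedByOne (n : ℕ) (c : (Fin n → ℕ) → ℂ) : Prop :=
  ∀ z ∈ hypercone n, Summable (fun α => c α * monomial α z) ∧ ‖∑' α, c α * monomial α z‖ < 1

/-- The numbers `r > 0` such that `∑ ‖c_α z^α‖_{L¹(μ_r)} < 1` for every power series which
converges in the unit hypercone to a sum of modulus less than `1`. The series of norms is summed
in `[0, ∞]`. -/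
def admissibleRadii (n : ℕ) : Set ℝ :=
  {r | 0 < r ∧ ∀ c : (Fin n → ℕ) → ℂ, BoundedByOne n c →
    ∑' α, eLpNorm (fun z => c α * monomial α z) 1 (muScaled n r) < 1}

/-- The `L¹` Bohr radius of the unit hypercone in `ℂⁿ`. -/
def bohrL1Radius (n : ℕ) : ℝ :=
  sSup (admissibleRadii n)

end BohrHypercone

end

/-!
The upper bound comes from the functions `φ (z₁ + ⋯ + zₙ)` with `φ w = (a - w) / (1 - a w)`. By
Dirichlet's integral, `z^α` has norm `r^k (n-1)! α! / (k+n-1)!` in `L¹(μ_r)`, where `k = |α|`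
(`eLpNorm_monomial`). The coefficient of `z^α` in `(z₁ + ⋯ + zₙ)^k` is `k! / α!`, and there are
`(k+n-1)! / (k! (n-1)!)` monomials of degree `k`, so the norms in degree `k` add up to exactly
`|φ_k| r^k` (`tsum_eLpNorm_extremalCoeff`). This reduces the upper bound to Bohr's one-variable
example: `∑ |φ_k| r^k = a + (1 - a²) r / (1 - a r)` equals `1` at `r = 1 / (1 + 2 a)`, which tends
to `1/3` as `a → 1`.

For the lower bound, let `f = ∑ c_α z^α` be bounded by `1` on the hypercone. On the torus of
polyradius `t` in the hypercone, `1 - Re (u f)` is nonnegative for `|u| = 1`, so its Fourier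
coefficients are at most its mean; hence `|c_α| t^α ≤ 2 (1 - |c_0|)` for `α ≠ 0`
(`norm_coeff_le_of_torus`). At `t = α / k` this reads `|c_α| α^α ≤ 2 (1 - |c_0|) k^k`. As
`α! ≤ α^α`, counting monomials bounds the norms in degree `k` by `2 (1 - |c_0|) k^k / k! r^k`
(`BoundedByOne.sum_norm_degree_le`). The total is therefore less than `1` as soon as
`∑_{k ≥ 1} k^k / k! r^k < 1/2`. The critical value is `r = e^{-1/3} / 3 = 0.2388437…`; the
inequality is checked at `r = 0.2388435` by summing 24 terms exactly and bounding the rest by a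
geometric series (`sum_treeTerm_le`).
-/

noncomputable section

namespace BohrHypercone

/-! ### Coefficient estimates from Fourier analysis on the torus -/

section Torus

open UnitAddTorus

/-- The normalized Haar measure on the torus `(ℝ/ℤ)^ι`. -/
def torusMeasure (ι : Type*) [Fintype ι] : Measure (UnitAddTorus ι) :=
  Measure.pi fun _ => AddCircle.haarAddCircle

instance (ι : Type*) [Fintype ι] : IsProbabilityMeasure (torusMeasure ι) := by
  unfold torusMeasure; infer_instance

lemma integral_fourier_haarAddCircle (k : ℤ) :
    ∫ x : UnitAddCircle, fourier k x ∂AddCircle.haarAddCircle = if k = 0 then 1 else 0 := by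
  have h := congrFun (fourierCoeff_fourier (T := 1) k) 0
  simpa [fourierCoeff, Pi.single_apply, eq_comm] using h

lemma integral_mFourier {ι : Type*} [Fintype ι] (k : ι → ℤ) :
    ∫ x, mFourier k x ∂torusMeasure ι = if k = 0 then 1 else 0 := by
  have h := integral_fintype_prod_eq_prod (𝕜 := ℂ)
    (μ := fun _ : ι => (AddCircle.haarAddCircle : Measure UnitAddCircle))
    (fun i x => fourier (k i) x)
  simp only [mFourier, torusMeasure, ContinuousMap.coe_mk]
  refine h.trans ?_
  simp only [integral_fourier_haarAddCircle, Finset.prod_ite_zero, Finset.mem_univ, true_imp_iff,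
    Finset.prod_const_one, funext_iff, Pi.zero_apply]

lemma norm_mFourier_apply {ι : Type*} [Fintype ι] (k : ι → ℤ) (x : UnitAddTorus ι) :
    ‖mFourier k x‖ = 1 := by
  simp only [mFourier, ContinuousMap.coe_mk, norm_prod, fourier_apply, Circle.norm_coe,
    Finset.prod_const_one]

lemma integrable_of_continuous {ι : Type*} [Fintype ι] {f : UnitAddTorus ι → ℂ}
    (hf : Continuous f) : Integrable f (torusMeasure ι) :=
  hf.integrable_of_hasCompactSupport (.of_compactSpace f)

variable {ι κ : Type*} [Fintype ι]

lemma continuous_tsum_mFourier {b : κ → ℂ} (hb : Summable fun β => ‖b β‖)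
    (e : κ → ι → ℤ) : Continuous fun x => ∑' β, b β * mFourier (e β) x := by
  refine continuous_tsum (fun β => by fun_prop) hb fun β x => ?_
  rw [norm_mul, norm_mFourier_apply, mul_one]

lemma integral_tsum_mFourier_mul [Countable κ] {b : κ → ℂ} (hb : Summable fun β => ‖b β‖)
    (e : κ → ι → ℤ) (k : ι → ℤ) :
    ∫ x, (∑' β, b β * mFourier (e β) x) * mFourier k x ∂torusMeasure ι =
      ∑' β, b β * if e β + k = 0 then 1 else 0 := by
  have h := hasSum_integral_of_summable_integral_norm (μ := torusMeasure ι)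
    (F := fun β x => b β * mFourier (e β + k) x)
    (fun β => integrable_of_continuous (by fun_prop)) (by
      simpa [norm_mFourier_apply] using hb)
  simp only [integral_const_mul, integral_mFourier] at h
  rw [h.tsum_eq]
  refine integral_congr_ae (Filter.Eventually.of_forall fun x => ?_)
  simp only [mFourier_add, ← mul_assoc, tsum_mul_right]

/-- If an absolutely convergent power series is bounded by `1` on the torus, then
`1 - Re (u F)` is a nonnegative function for each unimodular `u`, so its Fourier coefficients are
bounded by its mean. -/
lemma norm_coeff_le_of_torus {b : (ι → ℕ) → ℂ} (hb : Summable fun β => ‖b β‖)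
    (hF : ∀ x : UnitAddTorus ι, ‖∑' β, b β * mFourier (fun i => (β i : ℤ)) x‖ ≤ 1)
    {α : ι → ℕ} (hα : α ≠ 0) : ‖b α‖ ≤ 2 * (1 - ‖b 0‖) := by
  set e : (ι → ℕ) → ι → ℤ := fun β i => (β i : ℤ) with he
  set F : UnitAddTorus ι → ℂ := fun x => ∑' β, b β * mFourier (e β) x
  have hFc : Continuous F := continuous_tsum_mFourier hb e
  have heq : ∀ β γ : ι → ℕ, e β + -e γ = 0 ↔ β = γ := by
    intro β γ
    simp [he, funext_iff, add_neg_eq_zero]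
  have hint (γ : ι → ℕ) : ∫ x, F x * mFourier (-e γ) x ∂torusMeasure ι = b γ := by
    rw [integral_tsum_mFourier_mul hb]
    simp only [heq]
    rw [tsum_eq_single γ (fun β hβ => by simp [hβ])]
    simp
  have hint0 : ∫ x, F x ∂torusMeasure ι = b 0 := by
    have h := hint 0
    have h0 : -e 0 = 0 := by ext; simp [he]
    simpa [h0, mFourier_zero] using h
  have hintpos : ∫ x, F x * mFourier (e α) x ∂torusMeasure ι = 0 := by
    rw [integral_tsum_mFourier_mul hb]
    refine (tsum_congr fun β => ?_).trans tsum_zero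
    rw [if_neg, mul_zero]
    intro h
    apply hα
    ext i
    have := congrFun h i
    simp only [he, Pi.add_apply, Pi.zero_apply] at this ⊢
    omega
  have hα' : -e α ≠ 0 := by
    intro h
    apply hα
    ext i
    have := congrFun h i
    simp only [he, Pi.neg_apply, Pi.zero_apply] at this ⊢
    omega
  obtain ⟨u, hu, hub⟩ := RCLike.exists_norm_eq_mul_self (b 0)
  -- `G = 2 (1 - Re (u F))`
  set G : UnitAddTorus ι → ℂ := fun x => 2 - u * F x - star (u * F x) with hG
  have hGre (x) : G x = ((2 * (1 - (u * F x).re) : ℝ) : ℂ) := by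
    have := Complex.add_conj (u * F x)
    simp only [hG, Complex.star_def]
    push_cast at this ⊢
    linear_combination -this
  have hGnonneg (x) : 0 ≤ 2 * (1 - (u * F x).re) := by
    have h1 := Complex.re_le_norm (u * F x)
    rw [norm_mul, hu, one_mul] at h1
    linarith [hF x]
  have hG1 : ∫ x, G x ∂torusMeasure ι = ((2 * (1 - ‖b 0‖) : ℝ) : ℂ) := by
    have hi : Integrable (fun x => u * F x) (torusMeasure ι) :=
      integrable_of_continuous (by fun_prop)
    have hi' : Integrable (fun x => star (u * F x)) (torusMeasure ι) :=
      integrable_of_continuous (by fun_prop)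
    have h2 : ∫ x, star (u * F x) ∂torusMeasure ι = ‖b 0‖ := by
      simp only [Complex.star_def]
      rw [integral_conj, integral_const_mul, hint0]
      erw [← hub]
      simp
    simp only [hG]
    rw [integral_sub (by exact (integrable_const _).sub hi) hi', integral_sub (integrable_const _) hi,
      h2, integral_const_mul, hint0]
    erw [← hub]
    simp
    ring
  have hG2 : ∫ x, G x * mFourier (-e α) x ∂torusMeasure ι = -(u * b α) := by
    have e1 : ∀ x, G x * mFourier (-e α) x = 2 * mFourier (-e α) x
        - u * (F x * mFourier (-e α) x) - star u * star (F x * mFourier (e α) x) := by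
      intro x
      simp only [hG, star_mul', mFourier_neg, Complex.star_def]
      ring
    simp only [e1]
    have h2 : ∫ x, star (F x * mFourier (e α) x) ∂torusMeasure ι = 0 := by
      simp only [Complex.star_def]
      rw [integral_conj, hintpos, map_zero]
    rw [integral_sub (integrable_of_continuous (by fun_prop)) (integrable_of_continuous
      (by fun_prop)), integral_sub (integrable_of_continuous (by fun_prop))
      (integrable_of_continuous (by fun_prop)), integral_const_mul, integral_const_mul,
      integral_const_mul, h2, hint, integral_mFourier, if_neg hα']
    simp
  calc ‖b α‖ = ‖∫ x, G x * mFourier (-e α) x ∂torusMeasure ι‖ := by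
        rw [hG2, norm_neg, norm_mul, hu, one_mul]
    _ ≤ ∫ x, ‖G x * mFourier (-e α) x‖ ∂torusMeasure ι := norm_integral_le_integral_norm _
    _ = ∫ x, 2 * (1 - (u * F x).re) ∂torusMeasure ι := by
        refine integral_congr_ae (Filter.Eventually.of_forall fun x => ?_)
        simp only
        rw [norm_mul, norm_mFourier_apply, mul_one, hGre, Complex.norm_real,
          Real.norm_of_nonneg (hGnonneg x)]
    _ = 2 * (1 - ‖b 0‖) := by
        have := hG1
        simp only [hGre] at this
        rw [integral_complex_ofReal] at this
        exact_mod_cast this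

end Torus

/-! ### The Dirichlet integral -/

open Nat in
lemma integral_pow_mul_sub_pow (a b : ℕ) (s : ℝ) :
    ∫ x in (0 : ℝ)..s, x ^ a * (s - x) ^ b =
      a ! * b ! / (a + b + 1)! * s ^ (a + b + 1) := by
  induction b generalizing a with
  | zero =>
    have : ((a : ℝ) + 1) ≠ 0 := by positivity
    simp [Nat.factorial_succ]
    field_simp
  | succ b ih =>
    have hu : ∀ x ∈ Set.uIcc 0 s,
        HasDerivAt (fun x : ℝ => (s - x) ^ (b + 1)) (-((b + 1) * (s - x) ^ b)) x := by
      intro x _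
      have := ((hasDerivAt_id x).const_sub s).pow (b + 1)
      refine this.congr_deriv ?_
      simp
    have hv : ∀ x ∈ Set.uIcc 0 s,
        HasDerivAt (fun x : ℝ => x ^ (a + 1) / (a + 1)) (x ^ a) x := by
      intro x _
      have := (hasDerivAt_pow (a + 1) x).div_const ((a : ℝ) + 1)
      refine this.congr_deriv ?_
      have : ((a : ℝ) + 1) ≠ 0 := by positivity
      push_cast
      field_simp
    have h := intervalIntegral.integral_mul_deriv_eq_deriv_mul hu hv
      (Continuous.intervalIntegrable (by fun_prop) _ _)
      (Continuous.intervalIntegrable (by fun_prop) _ _)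
    have h2 : ∫ x in (0 : ℝ)..s, -((b + 1) * (s - x) ^ b) * (x ^ (a + 1) / (a + 1)) =
        -((b + 1) / (a + 1)) * ∫ x in (0 : ℝ)..s, x ^ (a + 1) * (s - x) ^ b := by
      rw [← intervalIntegral.integral_const_mul]
      congr 1 with x
      ring
    rw [h2, ih (a + 1)] at h
    have h3 : ∫ x in (0 : ℝ)..s, x ^ a * (s - x) ^ (b + 1) =
        ∫ x in (0 : ℝ)..s, (s - x) ^ (b + 1) * x ^ a := by
      congr 1 with x
      ring
    rw [h3, h, show a + (b + 1) + 1 = a + 1 + b + 1 by ring]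
    have : ((a : ℝ) + 1) ≠ 0 := by positivity
    simp [Nat.factorial_succ]
    field_simp

lemma lintegral_pow_mul_sub_pow (a b : ℕ) {s : ℝ} (hs : 0 ≤ s) :
    ∫⁻ x in Set.Icc 0 s, ENNReal.ofReal (x ^ a * (s - x) ^ b) =
      ENNReal.ofReal (a.factorial * b.factorial / (a + b + 1).factorial * s ^ (a + b + 1)) := by
  rw [← integral_pow_mul_sub_pow, intervalIntegral.integral_of_le hs, ← integral_Icc_eq_integral_Ioc,
    ofReal_integral_eq_lintegral_ofReal]
  · exact (Continuous.continuousOn (by fun_prop)).integrableOn_Icc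
  · refine (ae_restrict_iff' measurableSet_Icc).2 (Filter.Eventually.of_forall fun x hx => ?_)
    have h1 := hx.1
    have h2 : 0 ≤ s - x := sub_nonneg.2 hx.2
    simp only [Pi.zero_apply]
    positivity

/-- The solid simplex of size `s`. -/
def simplexOfSize (m : ℕ) (s : ℝ) : Set (Fin m → ℝ) :=
  {t | (∀ i, 0 ≤ t i) ∧ ∑ i, t i ≤ s}

lemma isClosed_simplexOfSize (m : ℕ) (s : ℝ) : IsClosed (simplexOfSize m s) := by
  have : simplexOfSize m s = (⋂ i, {t | 0 ≤ t i}) ∩ {t | ∑ i, t i ≤ s} := by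
    ext; simp [simplexOfSize]
  rw [this]
  exact (isClosed_iInter fun i => isClosed_le continuous_const (continuous_apply i)).inter
    (isClosed_le (by fun_prop) continuous_const)

lemma cons_mem_simplexOfSize {m : ℕ} {s x : ℝ} {t : Fin m → ℝ} :
    (Fin.cons x t : Fin (m + 1) → ℝ) ∈ simplexOfSize (m + 1) s ↔
      0 ≤ x ∧ t ∈ simplexOfSize m (s - x) := by
  simp only [simplexOfSize, Set.mem_ofPred_eq, Fin.forall_fin_succ, Fin.sum_univ_succ, Fin.cons_zero,
    Fin.cons_succ, le_sub_iff_add_le, and_assoc, add_comm]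

lemma simplexOfSize_eq_empty {m : ℕ} {s : ℝ} (hs : s < 0) : simplexOfSize m s = ∅ := by
  ext t
  simp only [simplexOfSize, Set.mem_ofPred_eq, Set.mem_empty_iff_false, iff_false, not_and, not_le]
  exact fun h => hs.trans_le (Finset.sum_nonneg fun i _ => h i)

open Nat in
/-- Dirichlet's integral over a simplex, with natural exponents. -/
lemma lintegral_simplexOfSize (m : ℕ) (α : Fin m → ℕ) (b : ℕ) {s : ℝ} (hs : 0 ≤ s) :
    ∫⁻ t in simplexOfSize m s, ENNReal.ofReal ((∏ i, t i ^ α i) * (s - ∑ i, t i) ^ b) =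
      ENNReal.ofReal ((∏ i, ((α i)! : ℝ)) * b ! / ((∑ i, α i) + b + m)! *
        s ^ ((∑ i, α i) + b + m)) := by
  classical
  induction m generalizing s with
  | zero =>
    have : simplexOfSize 0 s = Set.univ := by
      ext; simp [simplexOfSize, hs]
    have hb : (b ! : ℝ) ≠ 0 := by positivity
    simp [this, hb, volume_pi]
  | succ m ih =>
    have hmp := (volume_preserving_piFinSuccAbove (fun _ : Fin (m + 1) => ℝ) 0).symm
    have hcont : Continuous fun t : Fin (m + 1) → ℝ =>
        ENNReal.ofReal ((∏ i, t i ^ α i) * (s - ∑ i, t i) ^ b) := by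
      exact ENNReal.continuous_ofReal.comp (by fun_prop)
    have hmeas := hcont.measurable.indicator (isClosed_simplexOfSize (m + 1) s).measurableSet
    have hms := fun s => (isClosed_simplexOfSize m s).measurableSet
    rw [← lintegral_indicator (isClosed_simplexOfSize (m + 1) s).measurableSet,
      ← hmp.lintegral_comp hmeas, Measure.volume_eq_prod, lintegral_prod]
    swap
    · exact (hmeas.comp (MeasurableEquiv.measurable _)).aemeasurable
    have key (x : ℝ) : ∫⁻ t, (simplexOfSize (m + 1) s).indicator
        (fun t => ENNReal.ofReal ((∏ i, t i ^ α i) * (s - ∑ i, t i) ^ b))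
        ((MeasurableEquiv.piFinSuccAbove (fun _ : Fin (m + 1) => ℝ) 0).symm (x, t)) =
        (Set.Icc 0 s).indicator (fun x => ENNReal.ofReal
          ((∏ i, ((α (Fin.succ i))! : ℝ)) * b ! / ((∑ i, α (Fin.succ i)) + b + m)!) *
          ENNReal.ofReal (x ^ α 0 * (s - x) ^ ((∑ i, α (Fin.succ i)) + b + m))) x := by
      have e1 (t : Fin m → ℝ) : (MeasurableEquiv.piFinSuccAbove (fun _ : Fin (m + 1) => ℝ) 0).symm
          (x, t) = Fin.cons x t := Fin.insertNth_zero' x t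
      simp only [e1]
      by_cases hx : x ∈ Set.Icc 0 s
      · have hsx : 0 ≤ s - x := sub_nonneg.2 hx.2
        rw [Set.indicator_of_mem hx, ← ENNReal.ofReal_mul (by positivity)]
        have : ((∏ i, ((α (Fin.succ i))! : ℝ)) * b ! / ((∑ i, α (Fin.succ i)) + b + m)!) *
            (x ^ α 0 * (s - x) ^ ((∑ i, α (Fin.succ i)) + b + m)) = x ^ α 0 *
            (((∏ i, ((α (Fin.succ i))! : ℝ)) * b ! / ((∑ i, α (Fin.succ i)) + b + m)!) *
            (s - x) ^ ((∑ i, α (Fin.succ i)) + b + m)) := by ring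
        rw [this, ENNReal.ofReal_mul (pow_nonneg hx.1 _), ← ih _ hsx, ← lintegral_const_mul' _ _
          ENNReal.ofReal_ne_top, ← lintegral_indicator (hms _)]
        refine lintegral_congr fun t => ?_
        simp only [Set.indicator_apply, cons_mem_simplexOfSize, hx.1, true_and]
        split_ifs
        · rw [← ENNReal.ofReal_mul (pow_nonneg hx.1 _)]
          simp only [Fin.prod_univ_succ, Fin.sum_univ_succ, Fin.cons_zero, Fin.cons_succ]
          congr 1
          ring
        · rfl
      · rw [Set.indicator_of_notMem hx]
        refine (lintegral_congr fun t => ?_).trans lintegral_zero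
        rw [Set.indicator_of_notMem]
        rw [cons_mem_simplexOfSize]
        rintro ⟨h0, h⟩
        rw [simplexOfSize_eq_empty (by
          by_contra hcon
          exact hx ⟨h0, by linarith⟩)] at h
        exact h
    simp only [key]
    rw [lintegral_indicator measurableSet_Icc, lintegral_const_mul' _ _ ENNReal.ofReal_ne_top,
      lintegral_pow_mul_sub_pow _ _ hs, ← ENNReal.ofReal_mul (by positivity)]
    congr 1
    rw [Fin.prod_univ_succ, Fin.sum_univ_succ,
      show α 0 + ∑ i, α (Fin.succ i) + b + (m + 1) =
        α 0 + (∑ i, α (Fin.succ i) + b + m) + 1 by ring]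
    field_simp

/-! ### The norms of the monomials -/

lemma modulus_castSucc {m : ℕ} (t : Fin m → ℝ) (i : Fin m) :
    modulus (m + 1) t i.castSucc = t i := by
  simp [modulus]

lemma modulus_last {m : ℕ} (t : Fin m → ℝ) :
    modulus (m + 1) t (Fin.last m) = 1 - ∑ i, t i := by
  simp [modulus]

lemma measurable_polarPoint (m : ℕ) : Measurable (polarPoint (m + 1)) := by
  refine Continuous.measurable (continuous_pi fun i => ?_)
  unfold polarPoint
  have h : Continuous fun p : (Fin m → ℝ) × (Fin (m + 1) → ℝ) => modulus (m + 1) p.1 i := by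
    refine Fin.lastCases ?_ (fun i => ?_) i
    · simp only [modulus_last]; fun_prop
    · simp only [modulus_castSucc]; fun_prop
  have h2 : Continuous fun p : (Fin m → ℝ) × (Fin (m + 1) → ℝ) => (p.2 i : ℂ) := by fun_prop
  exact (Complex.continuous_ofReal.comp h).mul (Complex.continuous_exp.comp (h2.mul_const _))

lemma continuous_monomial {n : ℕ} (α : Fin n → ℕ) : Continuous (monomial α) := by
  unfold monomial; fun_prop

lemma norm_monomial_smul_polarPoint {m : ℕ} (α : Fin (m + 1) → ℕ) {r : ℝ} (hr : 0 ≤ r)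
    {t : Fin m → ℝ} (ht : t ∈ simplexOfSize m 1) (θ : Fin (m + 1) → ℝ) :
    ‖monomial α (r • polarPoint (m + 1) (t, θ))‖ = r ^ (∑ i, α i) *
      ((∏ i : Fin m, t i ^ α i.castSucc) * (1 - ∑ i, t i) ^ α (Fin.last m)) := by
  have hpos : ∀ i, 0 ≤ modulus (m + 1) t i := by
    refine Fin.lastCases ?_ (fun i => ?_)
    · rw [modulus_last]; linarith [ht.2]
    · rw [modulus_castSucc]; exact ht.1 i
  have h : ∀ i, ‖(r • polarPoint (m + 1) (t, θ)) i‖ = r * modulus (m + 1) t i := by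
    intro i
    simp only [Pi.smul_apply, polarPoint, norm_smul, Real.norm_eq_abs, abs_of_nonneg hr, norm_mul,
      Complex.norm_real, abs_of_nonneg (hpos i), Complex.norm_exp_ofReal_mul_I, mul_one]
  simp only [monomial, norm_prod, norm_pow, h, mul_pow]
  rw [Finset.prod_mul_distrib, Finset.prod_pow_eq_pow_sum, Fin.prod_univ_castSucc
    (fun i => modulus (m + 1) t i ^ α i)]
  simp only [modulus_castSucc, modulus_last]

open Nat in
lemma eLpNorm_monomial {m : ℕ} (α : Fin (m + 1) → ℕ) (c : ℂ) {r : ℝ} (hr : 0 ≤ r) :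
    eLpNorm (fun z => c * monomial α z) 1 (muScaled (m + 1) r) =
      ENNReal.ofReal (‖c‖ * (m ! * (∏ i, ((α i)! : ℝ)) / ((∑ i, α i) + m)! * r ^ (∑ i, α i))) := by
  have hm1 : Measurable fun z : Fin (m + 1) → ℂ => ‖c * monomial α z‖ₑ :=
    (continuous_const.mul (continuous_monomial α)).enorm.measurable
  have hsm : Measurable fun z : Fin (m + 1) → ℂ => r • z := by fun_prop
  have hbox : MeasurableSet (Set.univ.pi fun _ : Fin (m + 1) => Set.Ioc (0 : ℝ) (2 * Real.pi)) :=
    MeasurableSet.univ_pi fun _ => measurableSet_Ioc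
  have hsimp : MeasurableSet (simplexOfSize m 1) := (isClosed_simplexOfSize m 1).measurableSet
  rw [eLpNorm_one_eq_lintegral_enorm, muScaled, lintegral_map hm1 hsm, mu, lintegral_smul_measure,
    lintegral_map (f := fun z : Fin (m + 1) → ℂ => ‖c * monomial α (r • z)‖ₑ) (hm1.comp hsm) (measurable_polarPoint m)]
  change ENNReal.ofReal ((m ! : ℝ) / (2 * Real.pi) ^ (m + 1)) *
    ∫⁻ p : (Fin m → ℝ) × (Fin (m + 1) → ℝ), ‖c * monomial α (r • polarPoint (m + 1) p)‖ₑ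
      ∂((volume.restrict (simplexOfSize m 1)).prod (volume.restrict
        (Set.univ.pi fun _ : Fin (m + 1) => Set.Ioc (0 : ℝ) (2 * Real.pi)))) = _
  rw [Measure.prod_restrict,
    setLIntegral_congr_fun (g := fun p : (Fin m → ℝ) × (Fin (m + 1) → ℝ) =>
      ENNReal.ofReal (‖c‖ * r ^ (∑ i, α i)) * ENNReal.ofReal
      ((∏ i : Fin m, p.1 i ^ α i.castSucc) * (1 - ∑ i, p.1 i) ^ α (Fin.last m)))
      (hsimp.prod hbox), ← Measure.prod_restrict]
  swap
  · rintro ⟨t, θ⟩ ⟨ht, -⟩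
    simp only
    rw [← ofReal_norm, norm_mul, norm_monomial_smul_polarPoint α hr ht,
      ← ENNReal.ofReal_mul (by positivity), mul_assoc]
  have hmeas : Measurable fun t : Fin m → ℝ => ENNReal.ofReal
      ((∏ i : Fin m, t i ^ α i.castSucc) * (1 - ∑ i, t i) ^ α (Fin.last m)) :=
    (ENNReal.continuous_ofReal.comp (by fun_prop)).measurable
  have hvol : (volume : Measure (Fin (m + 1) → ℝ))
      (Set.univ.pi fun _ : Fin (m + 1) => Set.Ioc (0 : ℝ) (2 * Real.pi)) =
      ENNReal.ofReal ((2 * Real.pi) ^ (m + 1)) := by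
    rw [Real.volume_pi_Ioc, ← ENNReal.ofReal_prod_of_nonneg (by intros; simp; positivity)]
    simp
  rw [lintegral_const_mul' _ _ ENNReal.ofReal_ne_top, lintegral_prod _ (by
    exact (hmeas.comp measurable_fst).aemeasurable)]
  simp only [lintegral_const, Measure.restrict_apply_univ, hvol]
  rw [lintegral_mul_const _ hmeas]
  have hD := lintegral_simplexOfSize m (fun i => α i.castSucc) (α (Fin.last m)) zero_le_one
  rw [hD, ← ENNReal.ofReal_mul (by positivity), ← ENNReal.ofReal_mul
    (by positivity), ← ENNReal.ofReal_mul (by positivity)]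
  congr 1
  rw [Fin.prod_univ_castSucc (fun i => ((α i)! : ℝ)), Fin.sum_univ_castSucc]
  have := Real.pi_pos
  simp only [one_pow]
  field_simp

/-! ### Summation by degree -/

lemma card_piAntidiag_univ (m k : ℕ) :
    (Finset.piAntidiag (Finset.univ : Finset (Fin (m + 1))) k).card = (m + k).choose k := by
  rw [← Finset.map_sym_eq_piAntidiag, Finset.card_map, Finset.sym_univ, Finset.card_univ,
    Sym.card_sym_eq_choose, Fintype.card_fin]
  congr 1
  omega

lemma degree_preimage_singleton {n : ℕ} (k : ℕ) :
    (fun α : Fin n → ℕ => ∑ i, α i) ⁻¹' {k} =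
      (Finset.piAntidiag (Finset.univ : Finset (Fin n)) k : Set (Fin n → ℕ)) := by
  ext α; simp

lemma tsum_eq_tsum_degree {n : ℕ} (f : (Fin n → ℕ) → ENNReal) :
    ∑' α, f α = ∑' k, ∑ α ∈ Finset.piAntidiag (Finset.univ : Finset (Fin n)) k, f α := by
  rw [← ENNReal.tsum_fiberwise f (fun α => ∑ i, α i)]
  refine tsum_congr fun k => ?_
  rw [degree_preimage_singleton]
  exact Finset.tsum_subtype' _ _

lemma hasSum_degree {n : ℕ} {f : (Fin n → ℕ) → ℂ} (hf : Summable f) :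
    HasSum (fun k => ∑ α ∈ Finset.piAntidiag (Finset.univ : Finset (Fin n)) k, f α)
      (∑' α, f α) := by
  have h := hf.hasSum.tsum_fiberwise (fun α => ∑ i, α i)
  have e (k : ℕ) : ∑' b : (fun α : Fin n → ℕ => ∑ i, α i) ⁻¹' {k}, f b =
      ∑ α ∈ Finset.piAntidiag (Finset.univ : Finset (Fin n)) k, f α := by
    rw [degree_preimage_singleton]
    exact Finset.tsum_subtype' _ _
  simpa only [e] using h

/-! ### The numerical estimate -/

/-- The `k`-th term of the series `∑ k^k / k! * r^k`, at `r = 0.2388435`, which is slightly below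
the point `exp (-1/3) / 3` where the sum over `k ≥ 1` equals `1/2`. -/
def treeTerm (k : ℕ) : ℝ := (k : ℝ) ^ k / k.factorial * 0.2388435 ^ k

lemma treeTerm_nonneg (k : ℕ) : 0 ≤ treeTerm k := by unfold treeTerm; positivity

/-- The ratio of consecutive terms is `r (1 + 1/k)^k ≤ r e < 2/3`. -/
lemma treeTerm_succ_le (k : ℕ) : treeTerm (k + 1) ≤ 2 / 3 * treeTerm k := by
  have he : ((k : ℝ) + 1) ^ k ≤ Real.exp 1 * (k : ℝ) ^ k := by
    rcases Nat.eq_zero_or_pos k with rfl | hk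
    · simp
    · have hk' : (0 : ℝ) < k := by exact_mod_cast hk
      have h1 : (k : ℝ) + 1 ≤ k * Real.exp (1 / k) := by
        have := Real.add_one_le_exp (1 / (k : ℝ))
        calc (k : ℝ) + 1 = k * (1 / k + 1) := by field_simp; ring
          _ ≤ _ := by gcongr
      calc ((k : ℝ) + 1) ^ k ≤ (k * Real.exp (1 / k)) ^ k := by gcongr
        _ = Real.exp 1 * (k : ℝ) ^ k := by
          rw [mul_pow, ← Real.exp_nat_mul]
          field_simp
  have hlt := Real.exp_one_lt_d9
  have hk : (0 : ℝ) < k.factorial := by positivity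
  have e1 : treeTerm (k + 1) = ((k : ℝ) + 1) ^ k * (0.2388435 ^ (k + 1) / k.factorial) := by
    have : (k : ℝ) + 1 ≠ 0 := by positivity
    unfold treeTerm
    rw [Nat.factorial_succ]
    push_cast
    field_simp
    ring
  rw [e1]
  calc ((k : ℝ) + 1) ^ k * (0.2388435 ^ (k + 1) / k.factorial)
      ≤ Real.exp 1 * (k : ℝ) ^ k * (0.2388435 ^ (k + 1) / k.factorial) := by gcongr
    _ = (Real.exp 1 * 0.2388435) * treeTerm k := by
      unfold treeTerm; rw [pow_succ]; field_simp
    _ ≤ 2 / 3 * treeTerm k := by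
      gcongr
      · exact treeTerm_nonneg k
      · linarith

lemma sum_treeTerm_le_add (N M : ℕ) :
    ∑ k ∈ Finset.range (N + M), treeTerm (k + 1) + 3 * treeTerm (N + M + 1) ≤
      ∑ k ∈ Finset.range N, treeTerm (k + 1) + 3 * treeTerm (N + 1) := by
  induction M with
  | zero => simp
  | succ M ih =>
    rw [← add_assoc, Finset.sum_range_succ]
    linarith [treeTerm_succ_le (N + M + 1)]

lemma sum_treeTerm_le (N : ℕ) :
    ∑ k ∈ Finset.range N, treeTerm (k + 1) ≤ 0.4999995 := by
  have h1 : ∑ k ∈ Finset.range 24, treeTerm (k + 1) + 3 * treeTerm (24 + 1) ≤ 0.4999995 := by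
    simp only [Finset.sum_range_succ, Finset.sum_range_zero, treeTerm, Nat.factorial]
    norm_num
  have h2 := sum_treeTerm_le_add 24 N
  have h3 : ∑ k ∈ Finset.range N, treeTerm (k + 1) ≤
      ∑ k ∈ Finset.range (24 + N), treeTerm (k + 1) :=
    Finset.sum_le_sum_of_subset_of_nonneg (Finset.range_mono (by omega))
      fun k _ _ => treeTerm_nonneg _
  linarith [treeTerm_nonneg (24 + N + 1)]

/-! ### The lower bound -/

lemma monomial_zero {n : ℕ} (z : Fin n → ℂ) : monomial 0 z = 1 := by simp [monomial]

lemma BoundedByOne.norm_coeff_zero_lt {n : ℕ} {c : (Fin n → ℕ) → ℂ} (hc : BoundedByOne n c) :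
    ‖c 0‖ < 1 := by
  have h := (hc 0 (by simp [hypercone])).2
  rwa [tsum_eq_single 0, monomial_zero, mul_one] at h
  intro α hα
  obtain ⟨i, hi⟩ := Function.ne_iff.1 hα
  rw [monomial, Finset.prod_eq_zero (Finset.mem_univ i), mul_zero]
  simpa using hi

lemma BoundedByOne.norm_coeff_mul_prod_le {n : ℕ} {c : (Fin n → ℕ) → ℂ} (hc : BoundedByOne n c)
    {t : Fin n → ℝ} (ht : ∀ i, 0 ≤ t i) (ht1 : ∑ i, t i < 1) {α : Fin n → ℕ} (hα : α ≠ 0) :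
    ‖c α‖ * ∏ i, t i ^ α i ≤ 2 * (1 - ‖c 0‖) := by
  set b : (Fin n → ℕ) → ℂ := fun β => c β * monomial β (fun i => (t i : ℂ)) with hb
  have hbn : Summable fun β => ‖b β‖ :=
    (hc (fun i => (t i : ℂ)) (by simpa [hypercone, abs_of_nonneg, ht] using ht1)).1.norm
  have hF (x : UnitAddTorus (Fin n)) :
      ‖∑' β, b β * UnitAddTorus.mFourier (fun i => (β i : ℤ)) x‖ ≤ 1 := by
    have hz : (fun i => (t i : ℂ) * fourier 1 (x i)) ∈ hypercone n := by
      simpa [hypercone, abs_of_nonneg, ht, fourier_apply, Circle.norm_coe] using ht1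
    refine le_of_eq_of_le ?_ (hc _ hz).2.le
    congr 1
    refine tsum_congr fun β => ?_
    simp only [hb, monomial, mul_pow, Finset.prod_mul_distrib, UnitAddTorus.mFourier,
      ContinuousMap.coe_mk, fourier_apply, mul_assoc, natCast_zsmul, AddCircle.toCircle_nsmul,
      Circle.coe_pow, one_smul]
  have h := norm_coeff_le_of_torus hbn hF hα
  simpa [hb, monomial_zero, monomial, norm_prod, abs_of_nonneg, ht] using h

/-- The estimate at the point `t = α / |α|`, where `t^α` is largest on the simplex. -/
lemma BoundedByOne.norm_coeff_mul_prod_pow_self_le {n : ℕ} {c : (Fin n → ℕ) → ℂ}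
    (hc : BoundedByOne n c) {α : Fin n → ℕ} (hα : α ≠ 0) :
    ‖c α‖ * ∏ i, (α i : ℝ) ^ α i ≤
      2 * (1 - ‖c 0‖) * ((∑ i, α i : ℕ) : ℝ) ^ (∑ i, α i) := by
  set k := ∑ i, α i with hk
  have hk0 : (0 : ℝ) < k := by
    have : k ≠ 0 := by
      intro h
      apply hα
      ext i
      exact Finset.sum_eq_zero_iff.1 h i (Finset.mem_univ i)
    positivity
  have hlim : Filter.Tendsto (fun s : ℝ => ‖c α‖ * ∏ i, (s * (α i / k)) ^ α i)
      (nhdsWithin 1 (Set.Iio 1)) (nhds (‖c α‖ * ∏ i, ((1 : ℝ) * (α i / k)) ^ α i)) := by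
    refine Filter.Tendsto.mono_left (Continuous.tendsto ?_ 1) nhdsWithin_le_nhds
    fun_prop
  have hle : ‖c α‖ * ∏ i, ((1 : ℝ) * (α i / k)) ^ α i ≤ 2 * (1 - ‖c 0‖) := by
    refine le_of_tendsto hlim ?_
    filter_upwards [Ioo_mem_nhdsLT (zero_lt_one (α := ℝ))] with s hs
    refine hc.norm_coeff_mul_prod_le (fun i => mul_nonneg hs.1.le (by positivity)) ?_ hα
    rw [← Finset.mul_sum, ← Finset.sum_div, ← Nat.cast_sum, ← hk, div_self hk0.ne', mul_one]
    exact hs.2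
  simp only [one_mul, div_pow, Finset.prod_div_distrib, Finset.prod_pow_eq_pow_sum, ← hk] at hle
  rwa [← mul_div_assoc, div_le_iff₀ (by positivity)] at hle

open Nat in
/-- There are `(m + k).choose k` monomials of degree `k`, and `α! ≤ α^α` for each. -/
lemma BoundedByOne.sum_norm_degree_le {m : ℕ} {c : (Fin (m + 1) → ℕ) → ℂ}
    (hc : BoundedByOne (m + 1) c) {k : ℕ} (hk : k ≠ 0) {r : ℝ} (hr : 0 ≤ r) :
    ∑ α ∈ Finset.piAntidiag (Finset.univ : Finset (Fin (m + 1))) k,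
      ‖c α‖ * (m ! * (∏ i, ((α i)! : ℝ)) / ((∑ i, α i) + m)! * r ^ (∑ i, α i)) ≤
      2 * (1 - ‖c 0‖) * ((k : ℝ) ^ k / k ! * r ^ k) := by
  have hterm : ∀ α ∈ Finset.piAntidiag (Finset.univ : Finset (Fin (m + 1))) k,
      ‖c α‖ * (m ! * (∏ i, ((α i)! : ℝ)) / ((∑ i, α i) + m)! * r ^ (∑ i, α i)) ≤
      2 * (1 - ‖c 0‖) * (k : ℝ) ^ k * (m ! / (k + m)! * r ^ k) := by
    intro α hα
    have hα' : ∑ i, α i = k := by simpa using hα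
    have hα0 : α ≠ 0 := by
      rintro rfl
      simp at hα'
      omega
    have h1 := hc.norm_coeff_mul_prod_pow_self_le hα0
    have h2 : ∏ i, ((α i)! : ℝ) ≤ ∏ i, (α i : ℝ) ^ α i :=
      Finset.prod_le_prod (fun _ _ => by positivity)
        fun i _ => by exact_mod_cast Nat.factorial_le_pow (α i)
    rw [hα'] at h1 ⊢
    calc ‖c α‖ * (m ! * (∏ i, ((α i)! : ℝ)) / (k + m)! * r ^ k)
        = (‖c α‖ * ∏ i, ((α i)! : ℝ)) * (m ! / (k + m)! * r ^ k) := by ring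
      _ ≤ (‖c α‖ * ∏ i, (α i : ℝ) ^ α i) * (m ! / (k + m)! * r ^ k) := by gcongr
      _ ≤ _ := by gcongr
  refine (Finset.sum_le_sum hterm).trans (le_of_eq ?_)
  have hch : ((m + k).choose k : ℝ) = (k + m)! / (k ! * m !) := by
    rw [add_comm m k, Nat.cast_choose ℝ (Nat.le_add_right k m), Nat.add_sub_cancel_left]
  rw [Finset.sum_const, card_piAntidiag_univ, nsmul_eq_mul, hch]
  field_simp

lemma mem_admissibleRadii (m : ℕ) : (0.2388435 : ℝ) ∈ admissibleRadii (m + 1) := by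
  refine ⟨by norm_num, fun c hc => ?_⟩
  have hr : (0 : ℝ) ≤ 0.2388435 := by norm_num
  have hc0 := hc.norm_coeff_zero_lt
  simp only [eLpNorm_monomial _ _ hr]
  rw [tsum_eq_tsum_degree, tsum_eq_zero_add' ENNReal.summable]
  have h0 : ∑ α ∈ Finset.piAntidiag (Finset.univ : Finset (Fin (m + 1))) 0, ENNReal.ofReal
      (‖c α‖ * (m.factorial * (∏ i, ((α i).factorial : ℝ)) / ((∑ i, α i) + m).factorial *
        0.2388435 ^ (∑ i, α i))) = ENNReal.ofReal ‖c 0‖ := by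
    have : (m.factorial : ℝ) ≠ 0 := by positivity
    simp [this]
  have hk (k : ℕ) : ∑ α ∈ Finset.piAntidiag (Finset.univ : Finset (Fin (m + 1))) (k + 1),
      ENNReal.ofReal
      (‖c α‖ * (m.factorial * (∏ i, ((α i).factorial : ℝ)) / ((∑ i, α i) + m).factorial *
        0.2388435 ^ (∑ i, α i))) ≤ ENNReal.ofReal (2 * (1 - ‖c 0‖) * treeTerm (k + 1)) := by
    rw [← ENNReal.ofReal_sum_of_nonneg (fun α _ => by positivity)]
    exact ENNReal.ofReal_le_ofReal (hc.sum_norm_degree_le (Nat.succ_ne_zero k) hr)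
  have htail : ∑' k, ENNReal.ofReal (2 * (1 - ‖c 0‖) * treeTerm (k + 1)) ≤
      ENNReal.ofReal (2 * (1 - ‖c 0‖) * 0.4999995) := by
    refine ENNReal.tsum_le_of_sum_range_le fun N => ?_
    have h2 : 0 ≤ 2 * (1 - ‖c 0‖) := by linarith
    rw [← ENNReal.ofReal_sum_of_nonneg (fun k _ => mul_nonneg h2 (treeTerm_nonneg _)),
      ← Finset.mul_sum]
    exact ENNReal.ofReal_le_ofReal (mul_le_mul_of_nonneg_left (sum_treeTerm_le N) h2)
  rw [h0]
  calc _ ≤ ENNReal.ofReal ‖c 0‖ + ENNReal.ofReal (2 * (1 - ‖c 0‖) * 0.4999995) := by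
        gcongr
        exact (ENNReal.tsum_le_tsum hk).trans htail
    _ = ENNReal.ofReal (‖c 0‖ + 2 * (1 - ‖c 0‖) * 0.4999995) := by
        rw [ENNReal.ofReal_add (norm_nonneg _) (by nlinarith)]
    _ < 1 := by
        rw [ENNReal.ofReal_lt_one]
        linarith

/-! ### The upper bound -/

/-- The Taylor coefficients of the disk automorphism `w ↦ (a - w) / (1 - a w)`. -/
def mobiusCoeff (a : ℝ) (k : ℕ) : ℝ := if k = 0 then a else -((1 - a ^ 2) * a ^ (k - 1))

lemma hasSum_pow_pred {K : Type*} [NormedField K] [CompleteSpace K] {p q a w : K}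
    (h : ‖a * w‖ < 1) : HasSum (fun k : ℕ => (if k = 0 then p else q * a ^ (k - 1)) * w ^ k)
      (p + q * w / (1 - a * w)) := by
  rw [← hasSum_nat_add_iff' 1]
  have h1 := (hasSum_geometric_of_norm_lt_one h).mul_left (q * w)
  simp only [Nat.add_eq_zero_iff, one_ne_zero, and_false, if_false, Nat.add_sub_cancel,
    Finset.sum_range_one, if_true, pow_zero, mul_one, add_sub_cancel_left, div_eq_mul_inv]
  convert! h1 using 1
  ext k
  ring

lemma hasSum_mobiusCoeff {a : ℝ} (ha0 : 0 ≤ a) (ha1 : a < 1) {w : ℂ} (hw : ‖w‖ < 1) :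
    HasSum (fun k => (mobiusCoeff a k : ℂ) * w ^ k) ((a - w) / (1 - a * w)) := by
  have h : ‖(a : ℂ) * w‖ < 1 := by
    rw [norm_mul, Complex.norm_real, Real.norm_of_nonneg ha0]
    nlinarith [norm_nonneg w]
  have hne : (1 : ℂ) - a * w ≠ 0 := by
    intro h0
    rw [← sub_eq_zero.1 h0] at h
    simp at h
  have := hasSum_pow_pred (p := (a : ℂ)) (q := -(1 - (a : ℂ) ^ 2)) h
  convert! this using 1
  · ext k
    unfold mobiusCoeff
    split_ifs <;> push_cast <;> ring
  · field_simp
    ring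

lemma hasSum_abs_mobiusCoeff {a : ℝ} (ha0 : 0 ≤ a) (ha1 : a < 1) {r : ℝ} (hr0 : 0 ≤ r)
    (hr : r < 1) :
    HasSum (fun k => |mobiusCoeff a k| * r ^ k) (a + (1 - a ^ 2) * r / (1 - a * r)) := by
  have h : ‖a * r‖ < 1 := by
    rw [Real.norm_of_nonneg (by positivity)]
    nlinarith
  have := hasSum_pow_pred (p := a) (q := 1 - a ^ 2) h
  convert! this using 1
  ext k
  have h2 : 0 ≤ 1 - a ^ 2 := by nlinarith
  unfold mobiusCoeff
  split_ifs
  · rw [abs_of_nonneg ha0]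
  · rw [abs_neg, abs_of_nonneg (by positivity)]

lemma norm_mobius_lt_one {a : ℝ} (ha0 : 0 ≤ a) (ha1 : a < 1) {w : ℂ} (hw : ‖w‖ < 1) :
    ‖((a : ℂ) - w) / (1 - a * w)‖ < 1 := by
  have hw2 : w.re ^ 2 + w.im ^ 2 < 1 := by
    have := Complex.sq_norm w
    rw [Complex.normSq_apply] at this
    nlinarith [norm_nonneg w]
  have h : ‖(a : ℂ) - w‖ < ‖1 - (a : ℂ) * w‖ := by
    refine lt_of_pow_lt_pow_left₀ 2 (norm_nonneg _) ?_
    rw [Complex.sq_norm, Complex.sq_norm, Complex.normSq_apply, Complex.normSq_apply]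
    simp
    nlinarith [mul_pos (sub_pos.2 (show a ^ 2 < 1 by nlinarith)) (sub_pos.2 hw2)]
  rw [norm_div]
  exact (div_lt_one ((norm_nonneg _).trans_lt h)).2 h

/-- The coefficients of the power series of `φ (z₁ + ⋯ + zₙ)`, where
`φ w = (a - w) / (1 - a w)`. -/
def extremalCoeff (n : ℕ) (a : ℝ) (α : Fin n → ℕ) : ℂ :=
  mobiusCoeff a (∑ i, α i) * Nat.multinomial Finset.univ α

lemma sum_extremalCoeff_degree {n : ℕ} (a : ℝ) (z : Fin n → ℂ) (k : ℕ) :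
    ∑ α ∈ Finset.piAntidiag (Finset.univ : Finset (Fin n)) k, extremalCoeff n a α * monomial α z =
      mobiusCoeff a k * (∑ i, z i) ^ k := by
  rw [Finset.sum_pow_eq_sum_piAntidiag, Finset.mul_sum]
  refine Finset.sum_congr rfl fun α hα => ?_
  have hα' : ∑ i, α i = k := by simpa using hα
  rw [extremalCoeff, hα', monomial, mul_assoc]

lemma sum_norm_extremalCoeff_degree {n : ℕ} (a : ℝ) (z : Fin n → ℂ) (k : ℕ) :
    ∑ α ∈ Finset.piAntidiag (Finset.univ : Finset (Fin n)) k,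
      ‖extremalCoeff n a α * monomial α z‖ = |mobiusCoeff a k| * (∑ i, ‖z i‖) ^ k := by
  rw [Finset.sum_pow_eq_sum_piAntidiag, Finset.mul_sum]
  refine Finset.sum_congr rfl fun α hα => ?_
  have hα' : ∑ i, α i = k := by simpa using hα
  simp [extremalCoeff, hα', monomial, norm_prod, mul_assoc]

lemma boundedByOne_extremalCoeff {n : ℕ} {a : ℝ} (ha0 : 0 ≤ a) (ha1 : a < 1) :
    BoundedByOne n (extremalCoeff n a) := by
  intro z hz
  have hz' : ∑ i, ‖z i‖ < 1 := hz
  have hw : ‖∑ i, z i‖ < 1 := (norm_sum_le _ _).trans_lt hz'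
  have hs : Summable fun α => extremalCoeff n a α * monomial α z := by
    apply Summable.of_norm
    rw [← tsum_enorm_ne_top_iff_summable_norm, tsum_eq_tsum_degree]
    have h (k : ℕ) : ∑ α ∈ Finset.piAntidiag (Finset.univ : Finset (Fin n)) k,
        ‖extremalCoeff n a α * monomial α z‖ₑ =
        ENNReal.ofReal (|mobiusCoeff a k| * (∑ i, ‖z i‖) ^ k) := by
      rw [← sum_norm_extremalCoeff_degree, ENNReal.ofReal_sum_of_nonneg (fun _ _ => norm_nonneg _)]
      simp only [ofReal_norm]
    simp only [h]
    exact (hasSum_abs_mobiusCoeff ha0 ha1 (Finset.sum_nonneg fun i _ => norm_nonneg _)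
      hz').summable.tsum_ofReal_ne_top
  refine ⟨hs, ?_⟩
  have h := hasSum_degree hs
  simp only [sum_extremalCoeff_degree] at h
  rw [h.unique (hasSum_mobiusCoeff ha0 ha1 hw)]
  exact norm_mobius_lt_one ha0 ha1 hw

open Nat in
/-- The norms of the terms of degree `k` add up to exactly the one-variable quantity
`|φ_k| r^k`: each is `|φ_k| r^k` divided by the number of monomials of degree `k`. -/
lemma tsum_eLpNorm_extremalCoeff (m : ℕ) (a : ℝ) {r : ℝ} (hr : 0 ≤ r) :
    ∑' α, eLpNorm (fun z => extremalCoeff (m + 1) a α * monomial α z) 1 (muScaled (m + 1) r) =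
      ∑' k, ENNReal.ofReal (|mobiusCoeff a k| * r ^ k) := by
  simp only [eLpNorm_monomial _ _ hr]
  rw [tsum_eq_tsum_degree]
  refine tsum_congr fun k => ?_
  have hterm : ∀ α ∈ Finset.piAntidiag (Finset.univ : Finset (Fin (m + 1))) k,
      ENNReal.ofReal (‖extremalCoeff (m + 1) a α‖ *
        (m ! * (∏ i, ((α i)! : ℝ)) / ((∑ i, α i) + m)! * r ^ (∑ i, α i))) =
      ENNReal.ofReal (|mobiusCoeff a k| * r ^ k * (m ! * k ! / (k + m)!)) := by
    intro α hα
    have hα' : ∑ i, α i = k := by simpa using hα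
    have hsp : (∏ i, ((α i)! : ℝ)) * Nat.multinomial Finset.univ α = k ! := by
      rw [← hα']
      exact_mod_cast Nat.multinomial_spec Finset.univ α
    have hn : ‖extremalCoeff (m + 1) a α‖ =
        |mobiusCoeff a k| * Nat.multinomial Finset.univ α := by
      simp [extremalCoeff, hα']
    rw [hn, hα', ← hsp]
    congr 1
    ring
  rw [Finset.sum_congr rfl hterm, Finset.sum_const, card_piAntidiag_univ, nsmul_eq_mul,
    ← ENNReal.ofReal_natCast, ← ENNReal.ofReal_mul (by positivity)]
  congr 1
  rw [add_comm m k, Nat.cast_choose ℝ (Nat.le_add_right k m), Nat.add_sub_cancel_left]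
  field_simp

lemma le_of_mem_admissibleRadii {m : ℕ} {r : ℝ} (hr : r ∈ admissibleRadii (m + 1)) :
    r ≤ 1 / 3 := by
  by_contra! hlt
  obtain ⟨hr0, hr⟩ := hr
  set ρ := min r (1 / 2) with hρ
  have hρ1 : 1 / 3 < ρ := lt_min hlt (by norm_num)
  have hρ2 : ρ ≤ 1 / 2 := min_le_right _ _
  -- this `a` solves `a + (1 - a ^ 2) ρ / (1 - a ρ) = 1`, that is, `ρ = 1 / (1 + 2 a)`
  set a := (1 / ρ - 1) / 2 with ha
  have ha' : (1 + 2 * a) * ρ = 1 := by rw [ha]; field_simp; ring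
  have ha0 : 0 ≤ a := by nlinarith
  have ha1 : a < 1 := by nlinarith
  have h := hr _ (boundedByOne_extremalCoeff (n := m + 1) ha0 ha1)
  rw [tsum_eLpNorm_extremalCoeff m a hr0.le] at h
  have hsum := hasSum_abs_mobiusCoeff ha0 ha1 (by linarith : 0 ≤ ρ) (by linarith)
  have hone : a + (1 - a ^ 2) * ρ / (1 - a * ρ) = 1 := by
    have : 1 - a * ρ ≠ 0 := by nlinarith
    field_simp
    linear_combination (1 - a) * ha'
  rw [hone] at hsum
  have hle : (1 : ENNReal) ≤ ∑' k, ENNReal.ofReal (|mobiusCoeff a k| * r ^ k) := by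
    calc (1 : ENNReal) = ∑' k, ENNReal.ofReal (|mobiusCoeff a k| * ρ ^ k) := by
          rw [← ENNReal.ofReal_tsum_of_nonneg (fun k => by positivity) hsum.summable, hsum.tsum_eq,
            ENNReal.ofReal_one]
      _ ≤ _ := by
          refine ENNReal.tsum_le_tsum fun k => ENNReal.ofReal_le_ofReal ?_
          gcongr
          exact min_le_left _ _
  exact absurd h hle.not_gt

end BohrHypercone

end

theorem theorem7 (n : ℕ) (hn : 1 ≤ n) :
    (0.238843 : ℝ) < BohrHypercone.bohrL1Radius n ∧
      BohrHypercone.bohrL1Radius n ≤ 1 / 3 := by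
  obtain ⟨m, rfl⟩ : ∃ m, n = m + 1 := ⟨n - 1, by omega⟩
  have hub : ∀ r ∈ BohrHypercone.admissibleRadii (m + 1), r ≤ 1 / 3 :=
    fun _ => BohrHypercone.le_of_mem_admissibleRadii
  refine ⟨?_, csSup_le ⟨_, BohrHypercone.mem_admissibleRadii m⟩ hub⟩
  calc (0.238843 : ℝ) < 0.2388435 := by norm_num
    _ ≤ _ := le_csSup ⟨_, hub⟩ (BohrHypercone.mem_admissibleRadii m)
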